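/- Let $k\in\omega$. In the first-order language of set theory $\langle\in\rangle$ (with equality), let $S_k$ be the theory axiomatized by - $(V_n)$ for $n=0$ and $n=k$: $\forall x_0,\dots,x_{n-1}\,\exists y\,\forall t\,\bigl(t\in y\leftrightarrow\bigvee_{i<n}t=x_i\bigr)$; - $(E)$: $\forall x,y\,\bigl(\forall t\,(t\in x\leftrightarrow t\in y)\to x=y\bigr)$; - $(B_k)$: $\forall x,u_0,\dots,u_k\,\bigl(\bigwedge_{i\le k}u_i\in x\to\bigvee_{i<j\le k}u_i=u_j\bigr)$; - $(C_n)$ for every $n\ge1$: $\forall x_0,\dots,x_n\,\neg\bigl(\bigwedge_{i<n}x_i\in x_{i+1}\land x_n=x_0\bigr)$. A bounded existential formula is a formula of the form $\exists y_1\in z_1\cdots\exists y_m\in z_m\,\theta$, where $m\ge0$, $\theta$ is quantifier-free, each $z_i$ is a variable distinct from $y_i$, and $\exists y\in z\,\varphi$ abbreviates $\exists y\,(y\in z\land\varphi)$. (The formula $\bot$ is counted as quantifier-free.) Then every formula $\varphi(\bar x)$ in the language $\langle\in\rangle$ is equivalent over $S_k$ to a Boolean combination $\psi(\bar x)$, in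 the same free variables $\bar x$, of bounded existential formulas; that is, in every model of $S_k$ the formulas $\varphi$ and $\psi$ are satisfied by the same tuples. -/

import Mathlib

open FirstOrder

namespace HSet

/-- The only non-logical symbol of the language of set theory is a binary relation symbol. -/
inductive MemRel : ℕ → Type
  | mem : MemRel 2

/-- The first-order language (with equality) of set theory. -/
def setLang : FirstOrder.Language.{0, 0} := ⟨fun _ => Empty, MemRel⟩

/-- The membership symbol. -/
def memSym : setLang.Relations 2 := MemRel.mem

section Formulas

variable {α : Type*} {n : ℕ}

/-- A variable as a term: `Sum.inl a` is the free variable named `a`, and `Sum.inr i` is the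
`i`-th of the `n` further variables in scope (the ones available for quantification). -/
abbrev tvar (s : α ⊕ Fin n) : setLang.Term (α ⊕ Fin n) := FirstOrder.Language.Term.var s

/-- The atomic formula `s ∈ t`. -/
def mem (s t : α ⊕ Fin n) : setLang.BoundedFormula α n :=
  FirstOrder.Language.Relations.boundedFormula₂ memSym (tvar s) (tvar t)

/-- The atomic formula `s = t`. -/
def eq (s t : α ⊕ Fin n) : setLang.BoundedFormula α n :=
  FirstOrder.Language.Term.bdEqual (tvar s) (tvar t)

/-- The bounded quantifier `∃ y ∈ x, φ`, that is, `∃ y (y ∈ x ∧ φ)`, where `x` is any variable in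
scope and the new variable `y`, distinct from `x`, is the variable of index `n` of `φ`. -/
def exMem (x : α ⊕ Fin n) (φ : setLang.BoundedFormula α (n + 1)) : setLang.BoundedFormula α n :=
  (mem (Sum.inr (Fin.last n)) (x.map id Fin.castSucc) ⊓ φ).ex

/-- Bounded existential formulas: a finite string of bounded existential quantifiers
`∃ y ∈ x` followed by a quantifier-free formula. -/
inductive IsBoundedExistential : {n : ℕ} → setLang.BoundedFormula α n → Prop
  | of_isQF {n : ℕ} {φ : setLang.BoundedFormula α n} (h : φ.IsQF) : IsBoundedExistential φ
  | exMem {n : ℕ} (x : α ⊕ Fin n) {φ : setLang.BoundedFormula α (n + 1)}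
      (h : IsBoundedExistential φ) : IsBoundedExistential (exMem x φ)

/-- Boolean combinations of the formulas (with free variables in `α`) that satisfy `P`. -/
inductive IsBooleanCombination (P : setLang.Formula α → Prop) : setLang.Formula α → Prop
  | of {φ : setLang.Formula α} (h : P φ) : IsBooleanCombination P φ
  | bot : IsBooleanCombination P ⊥
  | not {φ : setLang.Formula α} (h : IsBooleanCombination P φ) : IsBooleanCombination P φ.not
  | inf {φ ψ : setLang.Formula α} (h₁ : IsBooleanCombination P φ)
      (h₂ : IsBooleanCombination P ψ) : IsBooleanCombination P (φ ⊓ ψ)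
  | sup {φ ψ : setLang.Formula α} (h₁ : IsBooleanCombination P φ)
      (h₂ : IsBooleanCombination P ψ) : IsBooleanCombination P (φ ⊔ ψ)

end Formulas

/-- A variable `i` of a sentence under construction (there are no free variables). -/
abbrev bv {n : ℕ} (i : Fin n) : Empty ⊕ Fin n := Sum.inr i

/-- `(V_n)`: `∀ x₀ … xₙ₋₁ ∃ y ∀ t (t ∈ y ↔ ⋁_{i<n} t = xᵢ)`. The variables are numbered
`x₀, …, xₙ₋₁, y, t`. -/
noncomputable def axV (n : ℕ) : setLang.Sentence :=
  ((mem (bv (Fin.last (n + 1))) (bv (Fin.last n).castSucc)).iff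
    (FirstOrder.Language.BoundedFormula.iSup fun i : Fin n =>
      eq (bv (Fin.last (n + 1))) (bv i.castSucc.castSucc))).all.ex.alls

/-- Extensionality `(E)`: `∀ x y (∀ t (t ∈ x ↔ t ∈ y) → x = y)`. -/
def axE : setLang.Sentence :=
  (((mem (bv (2 : Fin 3)) (bv 0)).iff (mem (bv 2) (bv 1))).all.imp (eq (bv 0) (bv 1))).alls

/-- Boundedness `(B_k)`: `∀ x u₀ … uₖ (⋀_{i≤k} uᵢ ∈ x → ⋁_{i<j≤k} uᵢ = uⱼ)`. The variables are
numbered `x, u₀, …, uₖ`. -/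
noncomputable def axB (k : ℕ) : setLang.Sentence :=
  ((FirstOrder.Language.BoundedFormula.iInf fun i : Fin (k + 1) => mem (bv i.succ) (bv 0)).imp
    (FirstOrder.Language.BoundedFormula.iSup fun p : {p : Fin (k + 1) × Fin (k + 1) // p.1 < p.2} =>
      eq (bv p.1.1.succ) (bv p.1.2.succ)) : setLang.BoundedFormula Empty (k + 2)).alls

/-- Acyclicity `(C_n)`: `∀ x₀ … xₙ ¬ (⋀_{i<n} xᵢ ∈ xᵢ₊₁ ∧ xₙ = x₀)`. -/
noncomputable def axC (n : ℕ) : setLang.Sentence :=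
  ((FirstOrder.Language.BoundedFormula.iInf fun i : Fin n => mem (bv i.castSucc) (bv i.succ)) ⊓
    eq (bv (Fin.last n)) (bv 0) : setLang.BoundedFormula Empty (n + 1)).not.alls

/-- The theory `S_k`. -/
def S (k : ℕ) : setLang.Theory :=
  {axV 0, axV k, axE, axB k} ∪ {σ | ∃ n : ℕ, 1 ≤ n ∧ σ = axC n}

end HSet

/-! ### Reachable sets and local isomorphisms. -/

namespace HSet

open Set Relation

variable {M N : Type*} {k : ℕ}

/-! The truth of a formula at a tuple depends only on the membership structure of the sets reachable
from finitely many entries in `d` steps, with `d` depending on the formula and `k`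
(`exists_realize_iff_of_isLocalIso`). This is a back-and-forth argument resting on
`exists_forall_extend`. Let `X` be what is reachable from a new element `c` in `d + 1` steps; it has
at most `K = (k + 1) ^ (d + 1)` elements. By pigeonhole, some ball `B` around the old entries meets
`X` in the same set as a ball whose radius is larger by `K + 1`. The given isomorphism is kept on
`B`, and the rest of `X` is rebuilt in the other model (`exists_extension`): elements at the
boundary go to iterated singletons far from the old entries and far from each other, and every other
set goes to the set of the images of its elements. Acyclicity and extensionality give injectivity.

Reachable sets are finite of bounded size, so bounded existential formulas can express that one
embeds in the other model. Embeddings in both directions force equal cardinalities, hence a local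
isomorphism (`exists_isLocalIso_of_agree`). So the formula depends only on the truth values of
finitely many bounded existential formulas, which makes it a Boolean combination of them. -/

/-- The elements of `x` with respect to the membership relation `R`. -/
def elts (R : M → M → Prop) (x : M) : Set M := {t | R t x}

@[simp] theorem mem_elts {R : M → M → Prop} {t x : M} : t ∈ elts R x ↔ R t x := Iff.rfl

/-- The semantic content of the theory `S k`: the elements are, up to a bijection, the sets of at
most `k` elements, and membership is acyclic. -/
structure IsSetModel (k : ℕ) (R : M → M → Prop) : Prop where
  exists_elts : ∀ s : Set M, s.encard ≤ k → ∃ y, elts R y = s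
  ext : ∀ x y, elts R x = elts R y → x = y
  encard_elts : ∀ x, (elts R x).encard ≤ k
  acyclic : ∀ x, ¬ TransGen R x x

/-- The elements reachable from `A` by at most `d` steps from a set to one of its elements. -/
def down (R : M → M → Prop) : ℕ → Set M → Set M
  | 0, A => A
  | d + 1, A => down R d A ∪ {y | ∃ x ∈ down R d A, R y x}

section Down

variable {R : M → M → Prop} {A B : Set M} {d e : ℕ} {x y : M}

@[simp] theorem down_zero : down R 0 A = A := rfl

theorem down_subset_succ : down R d A ⊆ down R (d + 1) A := subset_union_left

theorem down_mono_left (h : d ≤ e) : down R d A ⊆ down R e A := by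
  induction h with
  | refl => exact Subset.rfl
  | step _ ih => exact ih.trans down_subset_succ

theorem subset_down : A ⊆ down R d A := down_mono_left (Nat.zero_le d)

theorem mem_down_succ (hx : x ∈ down R d A) (h : R y x) : y ∈ down R (d + 1) A :=
  Or.inr ⟨x, hx, h⟩

theorem down_mono_right (h : A ⊆ B) : down R d A ⊆ down R d B := by
  induction d with
  | zero => exact h
  | succ d ih =>
    rintro y (hy | ⟨x, hx, hyx⟩)
    · exact Or.inl (ih hy)
    · exact Or.inr ⟨x, ih hx, hyx⟩

theorem down_union : down R d (A ∪ B) = down R d A ∪ down R d B := by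
  induction d with
  | zero => rfl
  | succ d ih =>
    ext y
    simp only [down, ih, mem_union, mem_ofPred_eq]
    grind

theorem down_down : down R e (down R d A) = down R (d + e) A := by
  induction e with
  | zero => rfl
  | succ e ih => rw [down, ih]; rfl

/-- One step replaces each point by itself and its at most `k` elements, which multiplies the size
by at most `k + 1`. -/
theorem IsSetModel.encard_down_le (hR : IsSetModel k R) {m : ℕ} (hA : A.encard ≤ m) :
    (down R d A).encard ≤ ((k + 1) ^ d * m : ℕ) := by
  induction d with
  | zero => simpa using hA
  | succ d ih =>
    have hfin : (down R d A).Finite := finite_of_encard_le_coe ih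
    have hsub : down R (d + 1) A ⊆ ⋃ x ∈ hfin.toFinset, insert x (elts R x) := by
      rintro y (hy | ⟨x, hx, hyx⟩)
      · exact mem_biUnion (x := y) (by simpa using hy) (mem_insert _ _)
      · exact mem_biUnion (x := x) (by simpa using hx) (mem_insert_of_mem _ hyx)
    have hins : ∀ x, (insert x (elts R x)).encard ≤ (k + 1 : ℕ) := fun x =>
      (encard_insert_le _ _).trans (by
        have := hR.encard_elts x
        push_cast
        gcongr)
    refine (encard_le_encard hsub).trans ?_
    have hsum : ∀ s : Finset M, (⋃ x ∈ s, insert x (elts R x)).encard ≤ (s.card * (k + 1) : ℕ) := by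
      classical
      intro s
      induction s using Finset.induction_on with
      | empty => simp
      | insert a s ha ih =>
        rw [Finset.set_biUnion_insert, Finset.card_insert_of_notMem ha]
        refine (encard_union_le _ _).trans ((add_le_add (hins a) ih).trans ?_)
        norm_cast
        apply le_of_eq
        ring
    refine (hsum _).trans ?_
    rw [hfin.encard_eq_coe_toFinset_card] at ih
    norm_cast at ih ⊢
    calc hfin.toFinset.card * (k + 1) ≤ (k + 1) ^ d * m * (k + 1) := Nat.mul_le_mul_right _ ih
      _ = (k + 1) ^ (d + 1) * m := by ring

end Down

/-- `f` matches the pairs in `P` and is an isomorphism of the sets reachable from the first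
components of `P` in `d + 1` steps, respecting the elements of sets reachable in `d` steps. -/
structure IsLocalIso (R : M → M → Prop) (R' : N → N → Prop) (d : ℕ) (P : Set (M × N))
    (f : M → N) : Prop where
  map_pair : ∀ p ∈ P, f p.1 = p.2
  injOn : InjOn f (down R (d + 1) (Prod.fst '' P))
  elts_map : ∀ x ∈ down R d (Prod.fst '' P), elts R' (f x) = f '' elts R x

namespace IsLocalIso

variable {R : M → M → Prop} {R' : N → N → Prop} {d e : ℕ} {P Q : Set (M × N)} {f : M → N}

theorem mono (h : IsLocalIso R R' e P f) (hd : d ≤ e) (hQ : Q ⊆ P) : IsLocalIso R R' d Q f where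
  map_pair p hp := h.map_pair p (hQ hp)
  injOn := h.injOn.mono
    ((down_mono_left (by omega)).trans (down_mono_right (image_mono hQ)))
  elts_map x hx := h.elts_map x
    (down_mono_left hd (down_mono_right (image_mono hQ) hx))

theorem image_down (h : IsLocalIso R R' d P f) {j : ℕ} (hj : j ≤ d + 1) :
    f '' down R j (Prod.fst '' P) = down R' j (Prod.snd '' P) := by
  induction j with
  | zero =>
    simp only [down_zero, image_image]
    exact image_congr h.map_pair
  | succ j ih =>
    have ih := ih (by omega)
    have he : ∀ x ∈ down R j (Prod.fst '' P), elts R' (f x) = f '' elts R x := fun x hx =>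
      h.elts_map x (down_mono_left (by omega) hx)
    simp only [down, image_union, ih]
    congr 1
    ext y
    constructor
    · rintro ⟨z, ⟨x, hx, hzx⟩, rfl⟩
      refine ⟨f x, ih ▸ mem_image_of_mem f hx, ?_⟩
      change f z ∈ elts R' (f x)
      rw [he x hx]
      exact mem_image_of_mem f hzx
    · rintro ⟨w, hw, hyw⟩
      rw [← ih] at hw
      obtain ⟨x, hx, rfl⟩ := hw
      change y ∈ elts R' (f x) at hyw
      rw [he x hx] at hyw
      obtain ⟨z, hz, rfl⟩ := hyw
      exact ⟨z, ⟨x, hx, hz⟩, rfl⟩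

theorem rel_iff (h : IsLocalIso R R' d P f) {x y : M} (hx : x ∈ down R (d + 1) (Prod.fst '' P))
    (hy : y ∈ down R d (Prod.fst '' P)) : R x y ↔ R' (f x) (f y) := by
  rw [← mem_elts (R := R'), h.elts_map y hy]
  constructor
  · exact fun hxy => mem_image_of_mem f hxy
  · rintro ⟨z, hz, hzx⟩
    rwa [← h.injOn (mem_down_succ hy hz) hx hzx]

/-- By `image_down`, `f` is a bijection between the reachable sets of the two sides, so its inverse
there is again a local isomorphism. This reduces "back" to "forth". -/
theorem exists_swap [Nonempty M] (h : IsLocalIso R R' d P f) :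
    ∃ g, IsLocalIso R' R d (Prod.swap '' P) g := by
  have hfst : Prod.fst '' (Prod.swap '' P) = Prod.snd '' P := by simp [image_image]
  have hl : ∀ x ∈ down R (d + 1) (Prod.fst '' P),
      Function.invFunOn f (down R (d + 1) (Prod.fst '' P)) (f x) = x := fun x hx =>
    h.injOn.leftInvOn_invFunOn hx
  refine ⟨Function.invFunOn f (down R (d + 1) (Prod.fst '' P)), ?_, ?_, ?_⟩
  · rintro _ ⟨p, hp, rfl⟩
    simp only [Prod.fst_swap, Prod.snd_swap, ← h.map_pair p hp]
    exact hl _ (subset_down (mem_image_of_mem _ hp))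
  · rw [hfst, ← h.image_down le_rfl]
    rintro _ ⟨x, hx, rfl⟩ _ ⟨y, hy, rfl⟩ hxy
    rw [hl x hx, hl y hy] at hxy
    rw [hxy]
  · rw [hfst, ← h.image_down (Nat.le_succ d)]
    rintro _ ⟨x, hx, rfl⟩
    rw [hl x (down_subset_succ hx), h.elts_map x hx, image_image]
    refine (Eq.trans (image_congr fun z hz => hl z (mem_down_succ hx hz)) (image_id' _)).symm

end IsLocalIso

/-! ### Extending a local isomorphism by one element. -/

/-- An increasing chain of subsets of a set with at most `K` elements is stationary at some
index `i ≤ K`. -/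
theorem exists_eq_succ_of_monotone {X : Set M} {K : ℕ} (hX : X.encard ≤ K) {s : ℕ → Set M}
    (hs : Monotone s) (hsX : ∀ i, s i ⊆ X) : ∃ i ≤ K, s (i + 1) = s i := by
  by_contra! hne
  have hcard : ∀ i ≤ K + 1, (i : ℕ∞) ≤ (s i).encard := by
    intro i hi
    induction i with
    | zero => simp
    | succ i ih =>
      have hss : s i ⊂ s (i + 1) := (hs (Nat.le_succ i)).ssubset_of_ne (hne i (by omega)).symm
      have hfin : (s i).Finite := (finite_of_encard_le_coe hX).subset (hsX i)
      have hlt := hfin.encard_lt_encard hss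
      push_cast
      exact Order.add_one_le_of_lt ((ih (by omega)).trans_lt hlt)
  have := (hcard (K + 1) le_rfl).trans ((encard_le_encard (hsX _)).trans hX)
  norm_cast at this
  omega

/-- Definition of a function by recursion along a height function. -/
theorem exists_rec_of_height (R : M → M → Prop) (h : M → ℕ) (I : Set M) (σ : M → N)
    (mk : Set N → N) :
    ∃ τ : M → N, (∀ x ∉ I, τ x = σ x) ∧
      ∀ x ∈ I, τ x = mk (τ '' {y | R y x ∧ h y < h x}) := by
  classical
  -- Membership is acyclic but perhaps not well-founded, so the recursion runs along `h` and ignores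
  -- elements that do not lower it.
  let F : ∀ x, (∀ y, h y < h x → N) → N := fun x rec =>
    if x ∈ I then mk {t | ∃ y, ∃ hy : h y < h x, R y x ∧ rec y hy = t} else σ x
  let τ : M → N := (measure h).wf.fix F
  have hτ : ∀ x, τ x = F x fun y _ => τ y := fun x => (measure h).wf.fix_eq F x
  refine ⟨τ, fun x hx => by rw [hτ]; simp [F, hx], fun x hx => ?_⟩
  rw [hτ]
  simp only [F, hx, if_true]
  congr 1
  ext t
  simp only [mem_image, mem_ofPred_eq, exists_prop]
  grind

namespace IsSetModel

variable {R : M → M → Prop} {R' : N → N → Prop}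

/-- Iterated singletons, distinct by acyclicity. They serve as fresh values whose only descents run
down the same tower. -/
theorem exists_tower (hR : IsSetModel k R) (hk : 0 < k) :
    ∃ s : ℕ → M, Function.Injective s ∧ ∀ n, elts R (s (n + 1)) = {s n} := by
  obtain ⟨o, -⟩ := hR.exists_elts ∅ (by simp)
  have h1 : ∀ x : M, ∃ y, elts R y = {x} := fun x =>
    hR.exists_elts {x} (by rw [encard_singleton]; exact_mod_cast hk)
  choose g hg using h1
  let s : ℕ → M := fun n => g^[n] o
  have hs : ∀ n, elts R (s (n + 1)) = {s n} := fun n => by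
    simp only [s, Function.iterate_succ_apply', hg]
  have hlt : ∀ m n, m < n → TransGen R (s m) (s n) := by
    intro m n hmn
    have hstep : ∀ n, R (s n) (s (n + 1)) := fun n => by
      change s n ∈ elts R (s (n + 1))
      rw [hs]; rfl
    induction hmn with
    | refl => exact .single (hstep m)
    | step _ ih => exact ih.tail (hstep _)
  refine ⟨s, fun m n hmn => ?_, hs⟩
  rcases lt_trichotomy m n with h | h | h
  · exact (hR.acyclic (s n) (hmn ▸ hlt m n h)).elim
  · exact h
  · exact (hR.acyclic (s n) (by simpa [hmn] using hlt n m h)).elim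

/-- The height of `x` counts the points of `X` strictly below it. If `y ∈ X` is an element of `x`,
it is counted for `x` but, by acyclicity, not for itself. -/
theorem exists_height (hR : IsSetModel k R) {X : Set M} {K : ℕ} (hX : X.encard ≤ K) :
    ∃ h : M → ℕ, (∀ x, h x ≤ K) ∧ ∀ x, ∀ y ∈ X, R y x → h y < h x := by
  have hfin : X.Finite := finite_of_encard_le_coe hX
  have hle := (encard_le_coe_iff_finite_ncard_le.1 hX).2
  refine ⟨fun x => {z ∈ X | TransGen R z x}.ncard,
    fun x => (ncard_le_ncard (sep_subset _ _) hfin).trans hle, fun x y hy hyx => ?_⟩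
  refine ncard_lt_ncard ⟨fun z hz => ⟨hz.1, hz.2.tail hyx⟩, fun hsub => ?_⟩
    (hfin.subset (sep_subset _ _))
  exact hR.acyclic y (hsub ⟨hy, .single hyx⟩ : y ∈ {z ∈ X | TransGen R z y}).2

/-- An isomorphism `σ` on a finite set `B` extends to a finite set `X`, provided that no element of
`X` outside `B` can be reached from `B` in `K` steps. -/
theorem exists_extension (hR : IsSetModel k R) (hR' : IsSetModel k R') (hk : 0 < k)
    {K : ℕ} (hK : 0 < K) {B X I : Set M} (hB : B.Finite) (hX : X.encard ≤ K)
    (hI : ∀ x ∈ I, elts R x ⊆ X) (hXB : X ∩ down R K B ⊆ B) {σ : M → N}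
    (hσ : InjOn σ (down R (K + 1) B))
    (hσe : ∀ x ∈ down R K B, elts R' (σ x) = σ '' elts R x) :
    ∃ τ : M → N, EqOn τ σ B ∧ InjOn τ (B ∪ X) ∧ ∀ x ∈ I, elts R' (τ x) = τ '' elts R x := by
  classical
  obtain ⟨s, hsinj, hs⟩ := hR'.exists_tower hk
  obtain ⟨h, hhK, hh⟩ := hR.exists_height hX
  have hXfin : X.Finite := finite_of_encard_le_coe hX
  obtain ⟨i, hi⟩ := countable_iff_exists_injOn.1 hXfin.countable
  have hDfin : (down R K B).Finite := by
    obtain ⟨m, hm⟩ := hB.exists_encard_eq_coe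
    exact finite_of_encard_le_coe (hR.encard_down_le hm.le)
  obtain ⟨m₀, hm₀⟩ : ∃ m₀, ∀ m ≥ m₀, s m ∉ σ '' down R K B := by
    obtain ⟨b, hb⟩ := ((hDfin.image σ).preimage hsinj.injOn).bddAbove
    refine ⟨b + 1, fun m hm hmem => ?_⟩
    have := hb hmem
    omega
  -- The value `s 0` for sets with more than `k` elements is never used.
  have hmk : ∀ t : Set N, ∃ y, t.encard ≤ k → elts R' y = t := fun t => by
    by_cases ht : t.encard ≤ k
    · obtain ⟨y, hy⟩ := hR'.exists_elts t ht
      exact ⟨y, fun _ => hy⟩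
    · exact ⟨s 0, fun h => (ht h).elim⟩
  choose mk hmk using hmk
  -- The gap `K + 1` exceeds every height, and the offset keeps descents of up to `K` steps beyond
  -- `m₀`.
  let μ : M → ℕ := fun u => m₀ + K + 1 + (K + 1) * i u
  -- On `B` the map is `σ`; boundary points, in `X` but not in `I ∪ B`, go to the tower; points of
  -- `I \ B` are rebuilt from their elements.
  obtain ⟨τ, hτo, hτI⟩ := exists_rec_of_height R h (I \ B)
    (fun x => if x ∈ X \ B then s (μ x) else σ x) mk
  have hτB : EqOn τ σ B := fun x hx => by rw [hτo x (by simp [hx])]; simp [hx]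
  have hτb : ∀ x ∈ X, x ∉ I → x ∉ B → τ x = s (μ x) := fun x hxX hxI hxB => by
    rw [hτo x (by simp [hxI])]; simp [hxX, hxB]
  have hτe : ∀ x ∈ I \ B, elts R' (τ x) = τ '' elts R x := by
    intro x hx
    have hset : {y | R y x ∧ h y < h x} = elts R x := by
      ext y
      exact ⟨fun hy => hy.1, fun hy => ⟨hy, hh x y (hI x hx.1 hy) hy⟩⟩
    rw [hτI x hx, hset]
    exact hmk _ ((encard_image_le _ _).trans (hR.encard_elts x))
  -- New values avoid old ones. If `τ x = σ z`, either all elements of `x` lie in `B` and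
  -- extensionality gives `x = z`, or an element of `x` outside `B` yields the same coincidence at
  -- smaller height. The radius `K - h x` leaves room for this descent.
  have hout : ∀ n, ∀ x ∈ X \ B, h x ≤ n → τ x ∉ σ '' down R (K - h x) B := by
    intro n
    induction n with
    | zero =>
      rintro x ⟨hxX, hxB⟩ hn ⟨z, hz, hzx⟩
      have hz : z ∈ down R K B := down_mono_left (Nat.sub_le _ _) hz
      by_cases hxI : x ∈ I
      · have hx0 : elts R x = ∅ := by
          refine eq_empty_of_forall_notMem fun y hy => ?_
          have := hh x y (hI x hxI hy) hy
          omega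
        have h1 := hτe x ⟨hxI, hxB⟩
        rw [← hzx, hσe z hz, hx0, image_empty, image_eq_empty] at h1
        exact hxB (hXB ⟨hxX, hR.ext z x (h1.trans hx0.symm) ▸ hz⟩)
      · rw [hτb x hxX hxI hxB] at hzx
        exact hm₀ (μ x) (by simp only [μ]; omega) ⟨z, hz, hzx⟩
    | succ n ih =>
      rintro x ⟨hxX, hxB⟩ hn ⟨z, hz, hzx⟩
      have hz' : z ∈ down R K B := down_mono_left (Nat.sub_le _ _) hz
      by_cases hxI : x ∈ I
      · have h1 := hτe x ⟨hxI, hxB⟩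
        rw [← hzx, hσe z hz'] at h1
        by_cases hall : elts R x ⊆ B
        · rw [image_congr fun y hy => hτB (hall hy)] at h1
          have h2 := (hσ.image_eq_image_iff (fun y hy => mem_down_succ hz' hy)
            (hall.trans subset_down)).1 h1
          exact hxB (hXB ⟨hxX, hR.ext z x h2 ▸ hz'⟩)
        · obtain ⟨y, hy, hyB⟩ := not_subset.1 hall
          have hyX := hI x hxI hy
          have hlt := hh x y hyX hy
          refine ih y ⟨hyX, hyB⟩ (by omega) ?_
          have h3 : τ y ∈ σ '' elts R z := h1 ▸ mem_image_of_mem τ hy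
          refine image_mono (fun w hw => ?_) h3
          have := hhK x
          exact down_mono_left (by omega) (mem_down_succ hz hw)
      · rw [hτb x hxX hxI hxB] at hzx
        exact hm₀ (μ x) (by simp only [μ]; omega) ⟨z, hz', hzx⟩
  have hnotσ : ∀ x ∈ X \ B, ∀ z ∈ B, τ x ≠ τ z := fun x hx z hz he =>
    hout _ x hx le_rfl ⟨z, subset_down hz, by rw [he, hτB hz]⟩
  -- A rebuilt set can land high in the tower only by stacking singletons on a boundary value, at
  -- most `h x` levels above it. The spacing of `μ` then excludes a collision with another boundary
  -- value.
  have htower : ∀ n, ∀ x ∈ I \ B, h x ≤ n → ∀ m ≥ m₀ + h x, τ x = s (m + 1) →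
      ∃ u ∈ X, u ∉ I ∧ u ∉ B ∧ μ u < m + 1 ∧ m + 1 ≤ μ u + h x := by
    intro n
    induction n with
    | zero =>
      rintro x hx hn m hm hxm
      have h1 := hτe x hx
      rw [hxm, hs] at h1
      obtain ⟨y, hy, hym⟩ := h1 ▸ mem_singleton (s m)
      have := hh x y (hI x hx.1 hy) hy
      omega
    | succ n ih =>
      rintro x hx hn m hm hxm
      have h1 := hτe x hx
      rw [hxm, hs] at h1
      obtain ⟨y, hy, hym⟩ := h1 ▸ mem_singleton (s m)
      have hyX := hI x hx.1 hy
      have hlt := hh x y hyX hy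
      by_cases hyB : y ∈ B
      · exact (hm₀ m (by omega) ⟨y, subset_down hyB, by rw [← hτB hyB, hym]⟩).elim
      by_cases hyI : y ∈ I
      · obtain ⟨m, rfl⟩ : ∃ m', m = m' + 1 := ⟨m - 1, by omega⟩
        obtain ⟨u, hu, huI, huB, h2, h3⟩ := ih y ⟨hyI, hyB⟩ (by omega) m (by omega) hym
        exact ⟨u, hu, huI, huB, by omega, by omega⟩
      · rw [hτb y hyX hyI hyB] at hym
        have := hsinj hym
        exact ⟨y, hyX, hyI, hyB, by omega, by omega⟩
  have hbi : ∀ x ∈ I \ B, ∀ u ∈ X, u ∉ I → u ∉ B → τ x ≠ τ u := by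
    intro x hx u hu huI huB he
    rw [hτb u hu huI huB] at he
    have hxK := hhK x
    obtain ⟨v, -, -, -, h1, h2⟩ := htower _ x hx le_rfl (m₀ + K + (K + 1) * i u) (by omega)
      (he.trans (congrArg s (by simp only [μ]; ring)))
    simp only [μ] at h1 h2
    have h3 : (K + 1) * i v < (K + 1) * i u + 1 := by omega
    have h4 : i v ≤ i u := le_of_mul_le_mul_left (Nat.lt_succ_iff.1 h3) (Nat.succ_pos K)
    have h5 : i v ≠ i u := fun h => by rw [h] at h1 h2; omega
    have h6 : (K + 1) * (i v + 1) ≤ (K + 1) * i u := Nat.mul_le_mul_left _ (by omega)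
    rw [Nat.mul_add] at h6
    omega
  have hbb : ∀ u ∈ X, u ∉ I → u ∉ B → ∀ v ∈ X, v ∉ I → v ∉ B → τ u = τ v → u = v := by
    intro u hu huI huB v hv hvI hvB he
    rw [hτb u hu huI huB, hτb v hv hvI hvB] at he
    have := hsinj he
    simp only [μ] at this
    exact hi hu hv (Nat.eq_of_mul_eq_mul_left (Nat.succ_pos K) (Nat.add_left_cancel this))
  -- For two rebuilt sets with equal values, injectivity at lower height identifies their elements,
  -- and extensionality applies.
  have hinj : ∀ n, ∀ x ∈ X, h x ≤ n → ∀ y ∈ X, τ x = τ y → x = y := by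
    intro n
    induction n using Nat.strong_induction_on with
    | _ n ih =>
    intro x hx hn y hy he
    by_cases hxB : x ∈ B <;> by_cases hyB : y ∈ B
    · rw [hτB hxB, hτB hyB] at he
      exact hσ (subset_down hxB) (subset_down hyB) he
    · exact (hnotσ y ⟨hy, hyB⟩ x hxB he.symm).elim
    · exact (hnotσ x ⟨hx, hxB⟩ y hyB he).elim
    by_cases hxI : x ∈ I <;> by_cases hyI : y ∈ I
    · have h1 : τ '' elts R x = τ '' elts R y := by
        rw [← hτe x ⟨hxI, hxB⟩, ← hτe y ⟨hyI, hyB⟩, he]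
      have key : ∀ z ∈ elts R x, ∀ w ∈ elts R y, τ z = τ w → z = w := fun z hz w hw hzw =>
        ih (h z) ((hh x z (hI x hxI hz) hz).trans_le hn) z (hI x hxI hz) le_rfl w
          (hI y hyI hw) hzw
      refine hR.ext x y (Subset.antisymm (fun z hz => ?_) fun w hw => ?_)
      · obtain ⟨w, hw, hwz⟩ := h1 ▸ mem_image_of_mem τ hz
        rwa [key z hz w hw hwz.symm]
      · obtain ⟨z, hz, hzw⟩ := h1 ▸ mem_image_of_mem τ hw
        rwa [← key z hz w hw hzw]
    · exact (hbi x ⟨hxI, hxB⟩ y hy hyI hyB he).elim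
    · exact (hbi y ⟨hyI, hyB⟩ x hx hxI hxB he.symm).elim
    · exact hbb x hx hxI hxB y hy hyI hyB he
  refine ⟨τ, hτB, ?_, fun x hx => ?_⟩
  · have hcross : ∀ x ∈ B, ∀ y ∈ X, τ x = τ y → x = y := by
      intro x hx y hy he
      by_cases hyB : y ∈ B
      · rw [hτB hx, hτB hyB] at he
        exact hσ (subset_down hx) (subset_down hyB) he
      · exact (hnotσ y ⟨hy, hyB⟩ x hx he.symm).elim
    rintro x (hx | hx) y (hy | hy) he
    · rw [hτB hx, hτB hy] at he
      exact hσ (subset_down hx) (subset_down hy) he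
    · exact hcross x hx y hy he
    · exact (hcross y hy x hx he.symm).symm
    · exact hinj _ x hx le_rfl y hy he
  · by_cases hxB : x ∈ B
    · rw [hτB hxB, hσe x (subset_down hxB)]
      -- Elements of a point of `B` are one step away, hence in `B` by `hXB` since `K ≥ 1`.
      refine (image_congr fun y hy => hτB (hXB ⟨hI x hx hy, ?_⟩)).symm
      exact down_mono_left hK (mem_down_succ (d := 0) hxB hy)
    · exact hτe x ⟨hx, hxB⟩

/-- The back-and-forth property of local isomorphisms. -/
theorem exists_forall_extend (k d : ℕ) : ∃ e : ℕ,
    ∀ {M : Type*} {N : Type*} {R : M → M → Prop} {R' : N → N → Prop}, IsSetModel k R →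
      IsSetModel k R' → ∀ {P : Set (M × N)}, P.Finite → (∃ f, IsLocalIso R R' e P f) →
        ∀ c, ∃ b, ∃ f, IsLocalIso R R' d (insert (c, b) P) f := by
  set K : ℕ := (k + 1) ^ (d + 1) with hKdef
  have hK : 0 < K := by positivity
  -- Candidate radii are `d + 1 + (K + 1) * i` for `i ≤ K`; the last one still needs `K + 1` further
  -- steps on which `σ` is controlled.
  refine ⟨d + 1 + (K + 1) * (K + 1), ?_⟩
  intro M N R R' hR hR' P hP ⟨σ, hσ⟩ c
  -- For `k = 0` there are no singletons, hence no tower, but extensionality leaves only the empty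
  -- set.
  rcases Nat.eq_zero_or_pos k with rfl | hk
  · have hM : ∀ x : M, elts R x = ∅ := fun x => by simpa using hR.encard_elts x
    have hN : ∀ x : N, elts R' x = ∅ := fun x => by simpa using hR'.encard_elts x
    refine ⟨σ c, σ, ?_, fun x _ y _ _ => hR.ext x y (by rw [hM, hM]), fun x _ => ?_⟩
    · rintro p (rfl | hp)
      · rfl
      · exact hσ.map_pair p hp
    · rw [hM, hN, image_empty]
  set A := Prod.fst '' P with hA
  have hX : (down R (d + 1) {c}).encard ≤ K := by
    simpa only [mul_one] using hR.encard_down_le (d := d + 1) (A := {c}) (m := 1) (by simp)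
  -- Stationarity at `i` says that the shell of width `K + 1` around the ball of index `i` contains
  -- no point reachable from `c`, which is the separation needed for the extension.
  obtain ⟨i, hiK, hi⟩ := exists_eq_succ_of_monotone hX
    (s := fun i => down R (d + 1) {c} ∩ down R (d + 1 + (K + 1) * i) A)
    (fun i j hij => inter_subset_inter_right _
      (down_mono_left (by have := Nat.mul_le_mul_left (K + 1) hij; omega)))
    (fun i => inter_subset_left)
  have hbound : d + 1 + (K + 1) * i + (K + 1) ≤ d + 1 + (K + 1) * (K + 1) := by
    have := Nat.mul_le_mul_left (K + 1) (Nat.add_le_add_right hiK 1)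
    rw [Nat.mul_succ] at this
    omega
  have hBfin : (down R (d + 1 + (K + 1) * i) A).Finite := by
    obtain ⟨m, hm⟩ := (hP.image Prod.fst).exists_encard_eq_coe
    exact finite_of_encard_le_coe (hR.encard_down_le hm.le)
  obtain ⟨τ, hτσ, hτinj, hτe⟩ := exists_extension hR hR' hk hK hBfin hX
    (I := down R d {c}) (fun x hx y hy => mem_down_succ hx hy)
    (fun x hx => by
      have : x ∈ down R (d + 1) {c} ∩ down R (d + 1 + (K + 1) * (i + 1)) A :=
        ⟨hx.1, by
          have := hx.2
          rw [down_down] at this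
          exact down_mono_left (by rw [Nat.mul_succ]; omega) this⟩
      rw [hi] at this
      exact this.2)
    (σ := σ)
    (hσ.injOn.mono (by rw [down_down]; exact down_mono_left (by omega)))
    (fun x hx => hσ.elts_map x (by rw [down_down] at hx; exact down_mono_left (by omega) hx))
  have hfst : Prod.fst '' insert (c, τ c) P = {c} ∪ A := by
    rw [image_insert_eq, ← hA, singleton_union]
  have hsub : down R (d + 1) A ⊆ down R (d + 1 + (K + 1) * i) A := down_mono_left (by omega)
  refine ⟨τ c, τ, ?_, ?_, ?_⟩
  · rintro p (rfl | hp)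
    · rfl
    · rw [hτσ (subset_down (mem_image_of_mem _ hp))]
      exact hσ.map_pair p hp
  · rw [hfst, down_union, union_comm]
    exact hτinj.mono (union_subset_union_left _ hsub)
  · rw [hfst, down_union]
    rintro x (hx | hx)
    · exact hτe x hx
    · rw [hτσ (hsub (down_subset_succ hx)), hσ.elts_map x (down_mono_left (by omega) hx)]
      exact (image_congr fun y hy => hτσ (hsub (mem_down_succ hx hy))).symm

end IsSetModel

end HSet

namespace HSet

open Set Relation FirstOrder.Language

/-! ### Semantics of the axioms. -/

section Semantics

variable {M : Type*} [setLang.Structure M]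

/-- The membership relation of a structure. -/
def memRel (M : Type*) [setLang.Structure M] (y x : M) : Prop :=
  Structure.RelMap memSym ![y, x]

variable {α : Type*} {n : ℕ} {v : α → M} {xs : Fin n → M}

@[simp] theorem realize_mem {s t : α ⊕ Fin n} :
    (mem s t).Realize v xs ↔ memRel M (Sum.elim v xs s) (Sum.elim v xs t) :=
  BoundedFormula.realize_rel₂

@[simp] theorem realize_eq {s t : α ⊕ Fin n} :
    (eq s t).Realize v xs ↔ Sum.elim v xs s = Sum.elim v xs t :=
  BoundedFormula.realize_bdEqual _ _

@[simp] theorem realize_exMem {s : α ⊕ Fin n} {φ : setLang.BoundedFormula α (n + 1)} :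
    (exMem s φ).Realize v xs ↔
      ∃ y, memRel M y (Sum.elim v xs s) ∧ φ.Realize v (Fin.snoc xs y : Fin (n + 1) → M) := by
  simp only [exMem, BoundedFormula.realize_ex, BoundedFormula.realize_inf, realize_mem,
    Sum.elim_inr, Fin.snoc_last]
  cases s <;> simp [Fin.snoc_castSucc]

end Semantics

section Models

variable {M : Type*} [setLang.Structure M] {k : ℕ}

theorem realize_axV {n : ℕ} : M ⊨ axV n ↔
    ∀ xs : Fin n → M, ∃ y, ∀ t, memRel M t y ↔ ∃ i, t = xs i := by
  simp only [Sentence.Realize, axV, BoundedFormula.realize_alls,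
    BoundedFormula.realize_ex, BoundedFormula.realize_all, BoundedFormula.realize_iff,
    realize_mem, BoundedFormula.realize_iSup, realize_eq, Sum.elim_inr, Fin.snoc_last,
    Fin.snoc_castSucc]

theorem realize_axE : M ⊨ axE ↔
    ∀ x y : M, (∀ t, memRel M t x ↔ memRel M t y) → x = y := by
  have h0 : ∀ (xs : Fin 2 → M) (t : M), (Fin.snoc xs t : Fin 3 → M) 0 = xs 0 := fun xs t =>
    Fin.snoc_castSucc (α := fun _ => M) t xs 0
  have h1 : ∀ (xs : Fin 2 → M) (t : M), (Fin.snoc xs t : Fin 3 → M) 1 = xs 1 := fun xs t =>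
    Fin.snoc_castSucc (α := fun _ => M) t xs 1
  have h2 : ∀ (xs : Fin 2 → M) (t : M), (Fin.snoc xs t : Fin 3 → M) 2 = t := fun xs t =>
    Fin.snoc_last (α := fun _ => M) t xs
  simp only [Sentence.Realize, axE, BoundedFormula.realize_alls,
    BoundedFormula.realize_all, BoundedFormula.realize_iff, BoundedFormula.realize_imp,
    realize_mem, realize_eq, Sum.elim_inr, h0, h1, h2]
  exact ⟨fun h x y => h ![x, y], fun h xs => h (xs 0) (xs 1)⟩

theorem realize_axB : M ⊨ axB k ↔
    ∀ (x : M) (u : Fin (k + 1) → M), (∀ i, memRel M (u i) x) → ¬ Function.Injective u := by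
  simp only [Sentence.Realize, axB, BoundedFormula.realize_alls,
    BoundedFormula.realize_imp, realize_mem, BoundedFormula.realize_iSup,
    BoundedFormula.realize_iInf, realize_eq, Sum.elim_inr]
  constructor
  · intro h x u hu hinj
    obtain ⟨⟨⟨i, j⟩, hij⟩, he⟩ := h (Fin.cons x u) (by simpa using hu)
    exact hij.ne (hinj (by simpa using he))
  · intro h xs hxs
    have := h (xs 0) (fun i => xs i.succ) hxs
    simp only [Function.Injective, not_forall] at this
    obtain ⟨i, j, he, hne⟩ := this
    rcases lt_or_gt_of_ne hne with hij | hij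
    · exact ⟨⟨(i, j), hij⟩, he⟩
    · exact ⟨⟨(j, i), hij⟩, he.symm⟩

theorem realize_axC {n : ℕ} : M ⊨ axC n ↔
    ∀ xs : Fin (n + 1) → M, (∀ i : Fin n, memRel M (xs i.castSucc) (xs i.succ)) →
      xs (Fin.last n) ≠ xs 0 := by
  simp only [Sentence.Realize, axC, BoundedFormula.realize_alls,
    BoundedFormula.realize_not, BoundedFormula.realize_inf, realize_mem,
    BoundedFormula.realize_iInf, realize_eq, Sum.elim_inr, not_and, ne_eq]

theorem exists_path_of_transGen {β : Type*} {r : β → β → Prop} {x y : β} (h : TransGen r x y) :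
    ∃ n, 1 ≤ n ∧ ∃ f : ℕ → β, f 0 = x ∧ f n = y ∧ ∀ i < n, r (f i) (f (i + 1)) := by
  induction h with
  | @single y h => exact ⟨1, le_rfl, fun i => if i = 0 then x else y, by simp, by simp, by simpa⟩
  | @tail y z _ hyz ih =>
    obtain ⟨n, hn, f, h0, hfn, hf⟩ := ih
    refine ⟨n + 1, by omega, fun i => if i ≤ n then f i else z, by simpa, by simp, fun i hi => ?_⟩
    rcases Nat.lt_succ_iff_lt_or_eq.1 hi with hi | rfl
    · simpa [hi.le, Nat.succ_le_of_lt hi] using hf i hi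
    · simpa [hfn] using hyz

/-- A smaller set is listed with repetitions, so `axV k` yields every nonempty set of at most `k`
elements. -/
theorem exists_range_eq_of_encard_le {β : Type*} {s : Set β} {k : ℕ} (hne : s.Nonempty)
    (hs : s.encard ≤ k) : ∃ f : Fin k → β, range f = s := by
  obtain ⟨hfin, hle⟩ := encard_le_coe_iff_finite_ncard_le.1 hs
  have := hne.to_subtype
  have := hfin.to_subtype
  have e : s ≃ Fin s.ncard := Finite.equivFinOfCardEq rfl
  let g : s ↪ Fin k := e.toEmbedding.trans (Fin.castLEEmb hle)
  refine ⟨fun i => (Function.invFun (β := Fin k) (α := s) g i : β), ?_⟩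
  ext x
  constructor
  · rintro ⟨i, rfl⟩
    exact Subtype.coe_prop _
  · intro hx
    exact ⟨g ⟨x, hx⟩, by simp [Function.leftInverse_invFun g.injective _]⟩

/-- `axV 0` is needed for the empty set, since for `k > 0` the sets given by `axV k` are nonempty.
-/
theorem isSetModel_memRel [M ⊨ S k] : IsSetModel k (memRel M) := by
  have hS : ∀ σ ∈ S k, M ⊨ σ := fun σ hσ => Theory.realize_sentence_of_mem (S k) hσ
  refine ⟨fun s hs => ?_, fun x y hxy => ?_, fun x => ?_, fun x hx => ?_⟩
  · rcases s.eq_empty_or_nonempty with rfl | hne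
    · obtain ⟨y, hy⟩ := realize_axV.1 (hS (axV 0) (by simp [S])) ![]
      exact ⟨y, eq_empty_of_forall_notMem fun t ht => by simpa using (hy t).1 ht⟩
    · obtain ⟨f, rfl⟩ := exists_range_eq_of_encard_le hne hs
      obtain ⟨y, hy⟩ := realize_axV.1 (hS (axV k) (by simp [S])) f
      refine ⟨y, ?_⟩
      ext t
      exact (hy t).trans (by simp [eq_comm])
  · exact realize_axE.1 (hS axE (by simp [S])) x y fun t => Set.ext_iff.1 hxy t
  · by_contra! hlt
    have hle : ((k + 1 : ℕ) : ℕ∞) ≤ (elts (memRel M) x).encard := by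
      push_cast
      exact Order.add_one_le_of_lt hlt
    obtain ⟨t, ht, hcard⟩ := exists_subset_encard_eq hle
    have hfin : t.Finite := finite_of_encard_eq_coe hcard
    have := hfin.to_subtype
    have hn : Nat.card t = k + 1 := by
      rw [Nat.card_coe_set_eq, ncard, hcard]; rfl
    let e := Finite.equivFinOfCardEq hn
    exact realize_axB.1 (hS (axB k) (by simp [S])) x (fun i => e.symm i)
      (fun i => ht (e.symm i).2) (Subtype.val_injective.comp e.symm.injective)
  · obtain ⟨n, hn, f, h0, hfn, hf⟩ := exists_path_of_transGen hx
    refine realize_axC.1 (hS (axC n) (Or.inr ⟨n, hn, rfl⟩)) (fun i => f i) (fun i => ?_) ?_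
    · simpa using hf i i.2
    · simp [h0, hfn]

end Models

/-! ### Local isomorphisms preserve formulas. -/

section BackAndForth

universe w

variable {α M N : Type*}

/-- The pairs of values of the variables in `s` and of all the indexed variables. -/
def valuePairs {n : ℕ} (s : Set α) (v : α → M) (w : α → N) (xs : Fin n → M) (ys : Fin n → N) :
    Set (M × N) :=
  (fun i => (v i, w i)) '' s ∪ range fun i => (xs i, ys i)

theorem valuePairs_mono {n : ℕ} {s t : Set α} (h : s ⊆ t) {v : α → M} {w : α → N}
    {xs : Fin n → M} {ys : Fin n → N} : valuePairs s v w xs ys ⊆ valuePairs t v w xs ys :=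
  union_subset_union_left _ (image_mono h)

theorem valuePairs_snoc {n : ℕ} (s : Set α) (v : α → M) (w : α → N) (xs : Fin n → M)
    (ys : Fin n → N) (a : M) (b : N) :
    valuePairs s v w (Fin.snoc xs a : Fin (n + 1) → M) (Fin.snoc ys b : Fin (n + 1) → N) =
      insert (a, b) (valuePairs s v w xs ys) := by
  have : (range fun i => ((Fin.snoc xs a : Fin (n + 1) → M) i, (Fin.snoc ys b : Fin (n + 1) → N) i))
      = insert (a, b) (range fun i => (xs i, ys i)) := by
    ext p
    simp only [mem_range, mem_insert_iff, Fin.exists_fin_succ', Fin.snoc_castSucc, Fin.snoc_last]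
    rw [or_comm, eq_comm (a := p)]
  rw [valuePairs, this, union_insert, valuePairs]

theorem fst_valuePairs {n : ℕ} (s : Set α) (v : α → M) (w : α → N) (xs : Fin n → M)
    (ys : Fin n → N) : Prod.fst '' valuePairs s v w xs ys = v '' s ∪ range xs := by
  simp [valuePairs, image_union, image_image, ← range_comp, Function.comp_def]

theorem swap_valuePairs {n : ℕ} (s : Set α) (v : α → M) (w : α → N) (xs : Fin n → M)
    (ys : Fin n → N) : Prod.swap '' valuePairs s v w xs ys = valuePairs s w v ys xs := by
  simp [valuePairs, image_union, image_image, ← range_comp, Function.comp_def]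

theorem finite_valuePairs {n : ℕ} {s : Set α} (hs : s.Finite) (v : α → M) (w : α → N)
    (xs : Fin n → M) (ys : Fin n → N) : (valuePairs s v w xs ys).Finite :=
  (hs.image _).union (finite_range _)

/-- Local isomorphisms of sufficiently large depth preserve a given formula. -/
theorem exists_realize_iff_of_isLocalIso {α : Type*} (k : ℕ) {n : ℕ}
    (φ : setLang.BoundedFormula α n) :
    ∃ (d : ℕ) (s : Set α), s.Finite ∧ ∀ {M N : Type w} [setLang.Structure M]
      [setLang.Structure N] [M ⊨ S k] [N ⊨ S k] [Nonempty M] [Nonempty N]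
      {v : α → M} {w : α → N} {xs : Fin n → M} {ys : Fin n → N},
      (∃ f, IsLocalIso (memRel M) (memRel N) d (valuePairs s v w xs ys) f) →
        (φ.Realize v xs ↔ φ.Realize w ys) := by
  have hvar : ∀ {n : ℕ} (t : setLang.Term (α ⊕ Fin n)), ∃ x, t = Term.var x := by
    rintro n (x | ⟨f, -⟩)
    · exact ⟨x, rfl⟩
    · exact f.elim
  have hatom : ∀ {n : ℕ} (x y : α ⊕ Fin n), ∃ s : Set α, s.Finite ∧
      ∀ {M N : Type w} {R : M → M → Prop} {R' : N → N → Prop}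
      {v : α → M} {w : α → N} {xs : Fin n → M} {ys : Fin n → N} {f : M → N},
      IsLocalIso R R' 0 (valuePairs s v w xs ys) f →
        (R (Sum.elim v xs x) (Sum.elim v xs y) ↔ R' (Sum.elim w ys x) (Sum.elim w ys y)) ∧
        (Sum.elim v xs x = Sum.elim v xs y ↔ Sum.elim w ys x = Sum.elim w ys y) := by
    intro n x y
    refine ⟨{a | Sum.inl a = x ∨ Sum.inl a = y}, ?_, ?_⟩
    · exact ((finite_singleton x).union (finite_singleton y)).preimage Sum.inl_injective.injOn
    · intro M N R R' v w xs ys f hf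
      have hx : (Sum.elim v xs x, Sum.elim w ys x) ∈
          valuePairs {a | Sum.inl a = x ∨ Sum.inl a = y} v w xs ys := by
        rcases x with a | i
        · exact Or.inl ⟨a, Or.inl rfl, rfl⟩
        · exact Or.inr ⟨i, rfl⟩
      have hy : (Sum.elim v xs y, Sum.elim w ys y) ∈
          valuePairs {a | Sum.inl a = x ∨ Sum.inl a = y} v w xs ys := by
        rcases y with a | i
        · exact Or.inl ⟨a, Or.inr rfl, rfl⟩
        · exact Or.inr ⟨i, rfl⟩
      have hx' := mem_image_of_mem Prod.fst hx
      have hy' := mem_image_of_mem Prod.fst hy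
      have hfx := hf.map_pair _ hx
      have hfy := hf.map_pair _ hy
      simp only at hfx hfy hx' hy'
      rw [← hfx, ← hfy]
      exact ⟨hf.rel_iff (subset_down hx') hy',
        (hf.injOn.eq_iff (subset_down hx') (subset_down hy')).symm⟩
  induction φ with
  | falsum => exact ⟨0, ∅, finite_empty, fun _ => Iff.rfl⟩
  | equal t₁ t₂ =>
    obtain ⟨x, rfl⟩ := hvar t₁
    obtain ⟨y, rfl⟩ := hvar t₂
    obtain ⟨s, hs, h⟩ := hatom x y
    refine ⟨0, s, hs, fun ⟨f, hf⟩ => ?_⟩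
    change (eq x y).Realize _ _ ↔ (eq x y).Realize _ _
    rw [realize_eq, realize_eq]
    exact (h hf).2
  | @rel n l R ts =>
    cases R
    obtain ⟨x, hx⟩ := hvar (ts 0)
    obtain ⟨y, hy⟩ := hvar (ts 1)
    obtain ⟨s, hs, h⟩ := hatom x y
    refine ⟨0, s, hs, fun ⟨f, hf⟩ => ?_⟩
    have hts : BoundedFormula.rel MemRel.mem ts = mem x y := by
      have : ts = ![Term.var x, Term.var y] := by
        funext i
        fin_cases i
        · exact hx
        · exact hy
      rw [this]
      rfl
    rw [hts, realize_mem, realize_mem]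
    exact (h hf).1
  | imp φ ψ ihφ ihψ =>
    obtain ⟨d, s, hs, h⟩ := ihφ
    obtain ⟨d', s', hs', h'⟩ := ihψ
    refine ⟨max d d', s ∪ s', hs.union hs', fun ⟨f, hf⟩ => ?_⟩
    rw [BoundedFormula.realize_imp, BoundedFormula.realize_imp,
      h ⟨f, hf.mono (le_max_left _ _) (valuePairs_mono subset_union_left)⟩,
      h' ⟨f, hf.mono (le_max_right _ _) (valuePairs_mono subset_union_right)⟩]
  | all φ ih =>
    obtain ⟨d, s, hs, h⟩ := ih
    obtain ⟨e, he⟩ := IsSetModel.exists_forall_extend k d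
    refine ⟨e, s, hs, ?_⟩
    intro M N _ _ _ _ _ _ v w xs ys hf
    rw [BoundedFormula.realize_all, BoundedFormula.realize_all]
    constructor
    · intro hall b
      have hf' : ∃ g, IsLocalIso (memRel N) (memRel M) e (valuePairs s w v ys xs) g := by
        obtain ⟨f, hf⟩ := hf
        rw [← swap_valuePairs]
        exact hf.exists_swap
      obtain ⟨a, g, hg⟩ := he isSetModel_memRel isSetModel_memRel
        (finite_valuePairs hs w v ys xs) hf' b
      rw [← valuePairs_snoc] at hg
      have hg' := hg.exists_swap
      rw [swap_valuePairs] at hg'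
      exact (h hg').1 (hall a)
    · intro hall a
      obtain ⟨b, g, hg⟩ := he isSetModel_memRel isSetModel_memRel
        (finite_valuePairs hs v w xs ys) hf a
      rw [← valuePairs_snoc] at hg
      exact (h ⟨g, hg⟩).2 (hall b)

end BackAndForth

end HSet

namespace HSet

open Set Relation FirstOrder.Language

/-! ### Bounded existential formulas and embeddings. -/

section Diagrams

universe w

variable {α : Type*} {n : ℕ}

theorem isQF_iInf {ι : Type*} [Finite ι] {f : ι → setLang.BoundedFormula α n}
    (h : ∀ i, (f i).IsQF) : (BoundedFormula.iInf f).IsQF := by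
  have : ∀ l : List ι, ((l.map f).foldr (· ⊓ ·) ⊤).IsQF := by
    intro l
    induction l with
    | nil => exact BoundedFormula.IsQF.top
    | cons i l ih => exact (h i).inf ih
  exact this _

theorem isQF_mem (x y : α ⊕ Fin n) : (mem x y).IsQF :=
  (BoundedFormula.IsAtomic.rel _ _).isQF

theorem isQF_eq (x y : α ⊕ Fin n) : (eq x y).IsQF :=
  (BoundedFormula.IsAtomic.equal _ _).isQF

open Classical in
/-- The formula saying which of the variables `x i` are equal and which are elements of which. -/
noncomputable def diagram {ι : Type*} [Finite ι] (x : ι → α ⊕ Fin n) (E R : Set (ι × ι)) :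
    setLang.BoundedFormula α n :=
  BoundedFormula.iInf fun p : ι × ι =>
    (if p ∈ E then eq (x p.1) (x p.2) else (eq (x p.1) (x p.2)).not) ⊓
      (if p ∈ R then mem (x p.1) (x p.2) else (mem (x p.1) (x p.2)).not)

theorem isQF_diagram {ι : Type*} [Finite ι] (x : ι → α ⊕ Fin n) (E R : Set (ι × ι)) :
    (diagram x E R).IsQF := by
  refine isQF_iInf fun p => BoundedFormula.IsQF.inf ?_ ?_
  · split_ifs
    · exact isQF_eq _ _
    · exact (isQF_eq _ _).not
  · split_ifs
    · exact isQF_mem _ _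
    · exact (isQF_mem _ _).not

theorem realize_diagram {ι : Type*} [Finite ι] {x : ι → α ⊕ Fin n} {E R : Set (ι × ι)}
    {M : Type*} [setLang.Structure M] {v : α → M} {xs : Fin n → M} :
    (diagram x E R).Realize v xs ↔ ∀ i j,
      ((i, j) ∈ E ↔ Sum.elim v xs (x i) = Sum.elim v xs (x j)) ∧
        ((i, j) ∈ R ↔ memRel M (Sum.elim v xs (x i)) (Sum.elim v xs (x j))) := by
  simp only [diagram, BoundedFormula.realize_iInf, BoundedFormula.realize_inf, Prod.forall]
  refine forall₂_congr fun i j => and_congr ?_ ?_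
  · split_ifs with h <;> simp [h]
  · split_ifs with h <;> simp [h]

/-- The maps `f` that match the pairs in `P` and are embeddings on `W`. -/
structure IsEmbeddingOn {M N : Type*} (R : M → M → Prop) (R' : N → N → Prop) (P : Set (M × N))
    (W : Set M) (f : M → N) : Prop where
  map_pair : ∀ p ∈ P, f p.1 = p.2
  injOn : InjOn f W
  rel_iff : ∀ x ∈ W, ∀ y ∈ W, R x y ↔ R' (f x) (f y)

/-- Finitely many quantifier-free formulas determine the values of finitely many variables up to
isomorphism. -/
theorem exists_diagrams {s : Set α} (hs : s.Finite) (n : ℕ) :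
    ∃ Δ : Set (setLang.BoundedFormula α n), Δ.Finite ∧ (∀ χ ∈ Δ, χ.IsQF) ∧
      ∀ {M : Type w} [setLang.Structure M] (v : α → M) (xs : Fin n → M),
        ∃ χ ∈ Δ, χ.Realize v xs ∧ ∀ {N : Type w} [setLang.Structure N] [Nonempty N] (w : α → N)
          (ys : Fin n → N), χ.Realize w ys → ∃ f,
            IsEmbeddingOn (memRel M) (memRel N) (valuePairs s v w xs ys) (v '' s ∪ range xs) f := by
  classical
  have := hs.to_subtype
  let x : s ⊕ Fin n → α ⊕ Fin n := Sum.map Subtype.val id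
  refine ⟨range fun g : Set ((s ⊕ Fin n) × (s ⊕ Fin n)) × Set ((s ⊕ Fin n) × (s ⊕ Fin n)) =>
    diagram x g.1 g.2, finite_range _, ?_, fun {M} _ v xs => ?_⟩
  · rintro _ ⟨g, rfl⟩
    exact isQF_diagram _ _ _
  refine ⟨_, ⟨({p | Sum.elim v xs (x p.1) = Sum.elim v xs (x p.2)},
    {p | memRel M (Sum.elim v xs (x p.1)) (Sum.elim v xs (x p.2))}), rfl⟩,
    realize_diagram.2 fun i j => ⟨Iff.rfl, Iff.rfl⟩, fun {N} _ _ w ys h => ?_⟩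
  rw [realize_diagram] at h
  let f : M → N := fun a => if ha : ∃ i, Sum.elim v xs (x i) = a then Sum.elim w ys (x ha.choose)
    else Classical.arbitrary N
  have hf : ∀ i, f (Sum.elim v xs (x i)) = Sum.elim w ys (x i) := by
    intro i
    have hex : ∃ j, Sum.elim v xs (x j) = Sum.elim v xs (x i) := ⟨i, rfl⟩
    simp only [f, dif_pos hex]
    exact (h _ i).1.1 hex.choose_spec
  have hW : ∀ a ∈ v '' s ∪ range xs, ∃ i, Sum.elim v xs (x i) = a := by
    rintro a (⟨i, hi, rfl⟩ | ⟨i, rfl⟩)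
    · exact ⟨Sum.inl ⟨i, hi⟩, rfl⟩
    · exact ⟨Sum.inr i, rfl⟩
  refine ⟨f, ?_, ?_, ?_⟩
  · rintro _ (⟨i, hi, rfl⟩ | ⟨i, rfl⟩)
    · exact hf (Sum.inl ⟨i, hi⟩)
    · exact hf (Sum.inr i)
  · intro a ha b hb hab
    obtain ⟨i, rfl⟩ := hW a ha
    obtain ⟨j, rfl⟩ := hW b hb
    rw [hf, hf] at hab
    exact (h i j).1.2 hab
  · intro a ha b hb
    obtain ⟨i, rfl⟩ := hW a ha
    obtain ⟨j, rfl⟩ := hW b hb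
    rw [hf, hf]
    exact (h i j).2

/-- Finitely many bounded existential formulas express the existence of embeddings of sets `W`
that are generated from the values of the variables by passing to elements, at most `m` times. -/
theorem exists_boundedExistentials {s : Set α} (hs : s.Finite) (m n : ℕ) :
    ∃ Δ : Set (setLang.BoundedFormula α n), Δ.Finite ∧ (∀ χ ∈ Δ, IsBoundedExistential χ) ∧
      ∀ {M : Type w} [setLang.Structure M] (v : α → M) (xs : Fin n → M) (W : Set M),
        v '' s ∪ range xs ⊆ W → (W \ (v '' s ∪ range xs)).encard ≤ m →
        (∀ A', v '' s ∪ range xs ⊆ A' → (∀ x ∈ A', ∀ y ∈ W, memRel M y x → y ∈ A') → W ⊆ A') →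
        ∃ χ ∈ Δ, χ.Realize v xs ∧ ∀ {N : Type w} [setLang.Structure N] [Nonempty N] (w : α → N)
          (ys : Fin n → N), χ.Realize w ys → ∃ f,
            IsEmbeddingOn (memRel M) (memRel N) (valuePairs s v w xs ys) W f := by
  induction m generalizing n with
  | zero =>
    obtain ⟨Δ, hΔ, hQF, h⟩ := exists_diagrams hs n
    refine ⟨Δ, hΔ, fun χ hχ => .of_isQF (hQF χ hχ), fun {M} _ v xs W hA hm _ => ?_⟩
    have : W \ (v '' s ∪ range xs) = ∅ := by simpa using hm
    rw [hA.antisymm' (sdiff_eq_empty.1 this)]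
    exact h v xs
  | succ m ih =>
    obtain ⟨Δ₀, hΔ₀, hQF, h₀⟩ := exists_diagrams hs n
    obtain ⟨Δ, hΔ, hB, h⟩ := ih (n + 1)
    have hvars : (Sum.inl '' s ∪ range Sum.inr : Set (α ⊕ Fin n)).Finite :=
      (hs.image _).union (finite_range _)
    refine ⟨Δ₀ ∪ image2 exMem (Sum.inl '' s ∪ range Sum.inr) Δ,
      hΔ₀.union (hvars.image2 _ hΔ), ?_, fun {M} _ v xs W hA hm hgen => ?_⟩
    · rintro χ (hχ | ⟨z, -, χ, hχ, rfl⟩)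
      · exact .of_isQF (hQF χ hχ)
      · exact .exMem z (hB χ hχ)
    by_cases hWA : W ⊆ v '' s ∪ range xs
    · rw [hA.antisymm' hWA]
      obtain ⟨χ, hχ, h1, h2⟩ := h₀ v xs
      exact ⟨χ, Or.inl hχ, h1, h2⟩
    -- Otherwise the values of the variables would already be closed under elements in `W`, contrary
    -- to generation. The new `y` lies in some named `x`, so a bounded quantifier can introduce it.
    obtain ⟨x, hx, y, hyW, hyx, hyA⟩ : ∃ x ∈ v '' s ∪ range xs, ∃ y ∈ W, memRel M y x ∧
        y ∉ v '' s ∪ range xs := by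
      by_contra! hcon
      exact hWA (hgen _ Subset.rfl hcon)
    obtain ⟨z, hz, rfl⟩ : ∃ z ∈ (Sum.inl '' s ∪ range Sum.inr : Set (α ⊕ Fin n)),
        Sum.elim v xs z = x := by
      rcases hx with ⟨i, hi, rfl⟩ | ⟨i, rfl⟩
      · exact ⟨Sum.inl i, Or.inl ⟨i, hi, rfl⟩, rfl⟩
      · exact ⟨Sum.inr i, Or.inr ⟨i, rfl⟩, rfl⟩
    have hA' : v '' s ∪ range (Fin.snoc xs y : Fin (n + 1) → M) =
        insert y (v '' s ∪ range xs) := by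
      have : range (Fin.snoc xs y : Fin (n + 1) → M) = insert y (range xs) := by
        ext a
        simp only [mem_range, mem_insert_iff, Fin.exists_fin_succ', Fin.snoc_castSucc,
          Fin.snoc_last]
        rw [or_comm, eq_comm (a := a)]
      rw [this, union_insert]
    obtain ⟨χ, hχ, h1, h2⟩ := h v (Fin.snoc xs y : Fin (n + 1) → M) W
      (by rw [hA']; exact insert_subset hyW hA)
      (by
        have heq : insert y (W \ insert y (v '' s ∪ range xs)) = W \ (v '' s ∪ range xs) := by
          ext a
          simp only [mem_insert_iff, mem_sdiff]
          grind
        rw [hA']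
        rw [← heq, encard_insert_of_notMem (by simp)] at hm
        push_cast at hm
        exact (ENat.add_le_add_iff_right ENat.one_ne_top).1 hm)
      (by
        rw [hA']
        exact fun A' hA' => hgen A' ((subset_insert _ _).trans hA'))
    refine ⟨exMem z χ, Or.inr ⟨z, hz, χ, hχ, rfl⟩, realize_exMem.2 ⟨y, hyx, h1⟩,
      fun {N} _ _ w ys hN => ?_⟩
    obtain ⟨y', -, hy'⟩ := realize_exMem.1 hN
    obtain ⟨f, hf⟩ := h2 w _ hy'
    rw [valuePairs_snoc] at hf
    exact ⟨f, fun p hp => hf.map_pair p (mem_insert_of_mem _ hp), hf.injOn, hf.rel_iff⟩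

theorem IsEmbeddingOn.mapsTo_down {M N : Type*} {R : M → M → Prop} {R' : N → N → Prop}
    {P : Set (M × N)} {d j : ℕ} {f : M → N}
    (hf : IsEmbeddingOn R R' P (down R d (Prod.fst '' P)) f) (hj : j ≤ d) :
    MapsTo f (down R j (Prod.fst '' P)) (down R' j (Prod.snd '' P)) := by
  induction j with
  | zero =>
    rintro _ ⟨p, hp, rfl⟩
    rw [hf.map_pair p hp]
    exact mem_image_of_mem _ hp
  | succ j ih =>
    rintro y (hy | ⟨x, hx, hyx⟩)
    · exact Or.inl (ih (by omega) hy)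
    · refine Or.inr ⟨f x, ih (by omega) hx, ?_⟩
      exact (hf.rel_iff y (down_mono_left hj (mem_down_succ hx hyx)) x
        (down_mono_left (by omega) hx)).1 hyx

/-- Embeddings in both directions are local isomorphisms. -/
theorem IsEmbeddingOn.isLocalIso {M N : Type*} {R : M → M → Prop} {R' : N → N → Prop}
    {P : Set (M × N)} {d : ℕ} {f : M → N} {g : N → M}
    (hf : IsEmbeddingOn R R' P (down R (d + 1) (Prod.fst '' P)) f)
    (hg : IsEmbeddingOn R' R (Prod.swap '' P) (down R' (d + 1) (Prod.snd '' P)) g)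
    (hfin : (down R' (d + 1) (Prod.snd '' P)).Finite) : IsLocalIso R R' d P f := by
  have hfst : Prod.fst '' (Prod.swap '' P) = Prod.snd '' P := by simp [image_image]
  have hsnd : Prod.snd '' (Prod.swap '' P) = Prod.fst '' P := by simp [image_image]
  have hgf : MapsTo g (down R' (d + 1) (Prod.snd '' P)) (down R (d + 1) (Prod.fst '' P)) := by
    have := (hfst.symm ▸ hg : IsEmbeddingOn R' R (Prod.swap '' P)
      (down R' (d + 1) (Prod.fst '' (Prod.swap '' P))) g).mapsTo_down le_rfl
    rwa [hfst, hsnd] at this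
  -- The injection `g` bounds the size of the target by that of the source, so the injective `f` is
  -- onto the finite target. Surjectivity ensures that `f x` has no elements outside the image.
  have himage : f '' down R (d + 1) (Prod.fst '' P) = down R' (d + 1) (Prod.snd '' P) := by
    refine hfin.eq_of_subset_of_encard_le' (hf.mapsTo_down le_rfl).image_subset ?_
    rw [hf.injOn.encard_image, ← hg.injOn.encard_image]
    exact encard_le_encard hgf.image_subset
  refine ⟨hf.map_pair, hf.injOn, fun x hx => Subset.antisymm (fun y hy => ?_) ?_⟩
  · have hyD : y ∈ down R' (d + 1) (Prod.snd '' P) :=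
      mem_down_succ (hf.mapsTo_down (Nat.le_succ d) hx) hy
    rw [← himage] at hyD
    obtain ⟨z, hz, rfl⟩ := hyD
    exact ⟨z, (hf.rel_iff z hz x (down_subset_succ hx)).2 hy, rfl⟩
  · rintro _ ⟨z, hz, rfl⟩
    exact (hf.rel_iff z (mem_down_succ hx hz) x (down_subset_succ hx)).1 hz

theorem down_subset_of_closed {M : Type*} {R : M → M → Prop} {A A' : Set M} {d : ℕ}
    (hA : A ⊆ A') (h : ∀ x ∈ A', ∀ y ∈ down R d A, R y x → y ∈ A') : down R d A ⊆ A' := by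
  have : ∀ j ≤ d, down R j A ⊆ A' := by
    intro j hj
    induction j with
    | zero => exact hA
    | succ j ih =>
      rintro y (hy | ⟨x, hx, hyx⟩)
      · exact ih (by omega) hy
      · exact h x (ih (by omega) hx) y (down_mono_left hj (mem_down_succ hx hyx)) hyx
  exact this d le_rfl

/-- Tuples that agree on finitely many bounded existential formulas are locally isomorphic. -/
theorem exists_isLocalIso_of_agree (k d : ℕ) {s : Set α} (hs : s.Finite) :
    ∃ Δ : Set (setLang.Formula α), Δ.Finite ∧ (∀ χ ∈ Δ, IsBoundedExistential χ) ∧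
      ∀ {M N : Type w} [setLang.Structure M] [setLang.Structure N] [M ⊨ S k] [N ⊨ S k]
        [Nonempty M] [Nonempty N] (v : α → M) (w : α → N),
        (∀ χ ∈ Δ, χ.Realize v ↔ χ.Realize w) →
          ∃ f, IsLocalIso (memRel M) (memRel N) d
            (valuePairs s v w (default : Fin 0 → M) (default : Fin 0 → N)) f := by
  obtain ⟨c, hc⟩ := hs.exists_encard_eq_coe
  obtain ⟨Δ, hΔ, hB, h⟩ := exists_boundedExistentials hs ((k + 1) ^ (d + 1) * c) 0
  have hcard : ∀ {M : Type w} [setLang.Structure M] [M ⊨ S k] (v : α → M),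
      (down (memRel M) (d + 1) (v '' s ∪ range (default : Fin 0 → M))).encard ≤
        ((k + 1) ^ (d + 1) * c : ℕ) := by
    intro M _ _ v
    refine isSetModel_memRel.encard_down_le ?_
    rw [range_eq_empty, union_empty, ← hc]
    exact encard_image_le _ _
  have key : ∀ {M N : Type w} [setLang.Structure M] [setLang.Structure N] [M ⊨ S k]
      [Nonempty N] (v : α → M) (w : α → N), (∀ χ ∈ Δ, Formula.Realize χ v → Formula.Realize χ w) →
      ∃ f, IsEmbeddingOn (memRel M) (memRel N)
        (valuePairs s v w (default : Fin 0 → M) (default : Fin 0 → N))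
        (down (memRel M) (d + 1) (v '' s ∪ range (default : Fin 0 → M))) f := by
    intro M N _ _ _ _ v w hvw
    obtain ⟨χ, hχ, h1, h2⟩ := h v default _ (subset_down (R := memRel M) (d := d + 1))
      ((encard_le_encard sdiff_subset).trans (hcard v))
      (fun A' hA' hcl => down_subset_of_closed hA' hcl)
    exact h2 w default (hvw χ hχ h1)
  refine ⟨Δ, hΔ, hB, fun {M N} _ _ _ _ _ _ v w hvw => ?_⟩
  obtain ⟨f, hf⟩ := key v w fun χ hχ => (hvw χ hχ).1
  obtain ⟨g, hg⟩ := key w v fun χ hχ => (hvw χ hχ).2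
  have hsnd : Prod.snd '' valuePairs s v w (default : Fin 0 → M) (default : Fin 0 → N) =
      w '' s ∪ range (default : Fin 0 → N) := by
    rw [← fst_valuePairs s w v default (default : Fin 0 → M), ← swap_valuePairs, image_image]
    simp
  rw [← fst_valuePairs s v w default (default : Fin 0 → N)] at hf
  rw [← swap_valuePairs, ← hsnd] at hg
  refine ⟨f, hf.isLocalIso hg ?_⟩
  rw [hsnd]
  exact finite_of_encard_le_coe (hcard w)

end Diagrams

/-! ### Boolean combinations from finitely many truth values. -/

section Definability

universe w

variable {α : Type*} {T : setLang.Theory} {Q : setLang.Formula α → Prop}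

/-- A class of tuples in models that only depends on finitely many formulas is defined by a Boolean
combination of these formulas. -/
theorem exists_isBooleanCombination {Δ : Set (setLang.Formula α)} (hΔ : Δ.Finite)
    (hQ : ∀ χ ∈ Δ, Q χ) (C : ∀ M : Theory.ModelType.{0, 0, w} T, (α → M) → Prop)
    (hC : ∀ (M N : Theory.ModelType.{0, 0, w} T) (v : α → M) (w : α → N),
      (∀ χ ∈ Δ, χ.Realize v ↔ χ.Realize w) → C M v → C N w) :
    ∃ ψ, IsBooleanCombination Q ψ ∧
      ∀ (M : Theory.ModelType.{0, 0, w} T) (v : α → M), ψ.Realize v ↔ C M v := by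
  induction Δ, hΔ using Set.Finite.induction_on generalizing C with
  | empty =>
    -- With no formulas to compare, the class contains all tuples or none.
    by_cases hex : ∃ (M : Theory.ModelType.{0, 0, w} T) (v : α → M), C M v
    · obtain ⟨M, v, hMv⟩ := hex
      refine ⟨_, .not .bot, fun N w => ?_⟩
      simp [Formula.Realize, hC M N v w (by simp) hMv]
    · push Not at hex
      exact ⟨⊥, .bot, fun M v => by simp [Formula.Realize, hex M v]⟩
  | @insert χ Δ _ _ ih =>
    -- The tuples agreeing on `Δ` with some member of the class at which `χ` has truth value `q`.
    -- This depends on `Δ` alone, so the induction hypothesis defines it.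
    have split : ∀ q : Prop, ∃ ψ, IsBooleanCombination Q ψ ∧
        ∀ (M : Theory.ModelType.{0, 0, w} T) (v : α → M), ψ.Realize v ↔
          ∃ (N : Theory.ModelType.{0, 0, w} T) (w : α → N), C N w ∧ (χ.Realize w ↔ q) ∧
            ∀ χ' ∈ Δ, χ'.Realize w ↔ χ'.Realize v := by
      refine fun q => ih (fun χ' hχ' => hQ χ' (mem_insert_of_mem _ hχ')) _ ?_
      rintro M N v w hvw ⟨L, u, hL, hq, hu⟩
      exact ⟨L, u, hL, hq, fun χ' hχ' => (hu χ' hχ').trans (hvw χ' hχ')⟩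
    obtain ⟨ψ₁, hψ₁, h₁⟩ := split True
    obtain ⟨ψ₂, hψ₂, h₂⟩ := split False
    have hχ : IsBooleanCombination Q χ := .of (hQ χ (mem_insert _ _))
    refine ⟨(χ ⊓ ψ₁) ⊔ (χ.not ⊓ ψ₂), .sup (.inf hχ hψ₁) (.inf (.not hχ) hψ₂), fun M v => ?_⟩
    rw [Formula.realize_sup, Formula.realize_inf, Formula.realize_inf, Formula.realize_not, h₁, h₂]
    constructor
    · rintro (⟨hv, N, w, hN, hw, hvw⟩ | ⟨hv, N, w, hN, hw, hvw⟩)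
      · refine hC N M w v ?_ hN
        rintro χ' (rfl | hχ')
        · simp [hv, hw]
        · exact hvw χ' hχ'
      · refine hC N M w v ?_ hN
        rintro χ' (rfl | hχ')
        · simp [hv, hw]
        · exact hvw χ' hχ'
    · intro hM
      by_cases hv : χ.Realize v
      · exact Or.inl ⟨hv, M, v, hM, by simp [hv], fun _ _ => Iff.rfl⟩
      · exact Or.inr ⟨hv, M, v, hM, by simp [hv], fun _ _ => Iff.rfl⟩

end Definability

end HSet

theorem mainTheorem3 (k : ℕ) {α : Type*} (φ : HSet.setLang.Formula α) :
    ∃ ψ : HSet.setLang.Formula α,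
      HSet.IsBooleanCombination (fun χ => HSet.IsBoundedExistential χ) ψ ∧
        φ ⇔[HSet.S k] ψ := by
  obtain ⟨d, s, hs, hφ⟩ := HSet.exists_realize_iff_of_isLocalIso k φ
  obtain ⟨Δ, hΔ, hB, h⟩ := HSet.exists_isLocalIso_of_agree k d hs
  obtain ⟨ψ, hψ, hiff⟩ := HSet.exists_isBooleanCombination (T := HSet.S k) hΔ hB
    (fun M v => φ.Realize v)
    (fun M N v w hvw => (hφ (xs := default) (ys := default) (h v w hvw)).1)
  refine ⟨ψ, hψ, fun M v xs => ?_⟩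
  rw [FirstOrder.Language.BoundedFormula.realize_iff, Subsingleton.elim xs default]
  exact (hiff M v).symm
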